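/- Let $m\ge 3$ be an integer and let $D\subset\{0,1,\dots,m-1\}$ be a set of digits with $1<\#D<m$. Let \[ K_{m,D}=\left\{\sum_{j=1}^\infty \frac{a_j}{m^j} : a_j\in D\text{ for all } j\ge 1\right\} \] be the associated missing-digit set, and for $n\ge 1$ let $a_n=\prod_{k=1}^n k!$. Then the intersection \[ \left\{\frac{1}{a_n} : n\ge 1\right\}\cap K_{m,D} \] is finite. -/

import Mathlib

/-- The set `K_{m,D}` of all real numbers `∑_{j ≥ 1} a_j / m ^ j` with every digit `a_j` in `D`.
The sequence is indexed from `0`, so that `a j` is the digit of `m ^ (-(j + 1))`. -/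
def missingDigitSet (m : ℕ) (D : Finset ℕ) : Set ℝ :=
  {x | ∃ a : ℕ → ℕ, (∀ j, a j ∈ D) ∧ HasSum (fun j => (a j : ℝ) / (m : ℝ) ^ (j + 1)) x}

/-! Fix a prime `p > m` and a missing digit `d`. The set is invariant under `x ↦ m * x` modulo 1 and
avoids the open interval `(d / m, (d + 1) / m)`, even modulo 1. An orbit containing a full coset of
`(1 / p) ℤ / ℤ` must enter this interval, since `1 / p < 1 / m`; `one_div_notMem_missingDigitSet`
thus reduces the claim to arithmetic of the denominator `q`. For large indices,
`exists_pow_mul_pow_sub_one_eq_superFactorial_mul` chooses `S` so that `m ^ S - 1` absorbs the part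
of `q` prime to `p` (up to a power of `m`) and all but one factor `p`. -/

open Finset in
/-- Points of a missing-digit set are obtained by prepending a digit to another such point. -/
lemma missingDigitSet_exists_shift {m : ℕ} (hm : 0 < m) {D : Finset ℕ} {x : ℝ}
    (hx : x ∈ missingDigitSet m D) :
    ∃ c ∈ D, (m : ℝ) * x - c ∈ missingDigitSet m D := by
  obtain ⟨a, ha, hs⟩ := hx
  have hm' : (m : ℝ) ≠ 0 := by positivity
  refine ⟨a 0, ha 0, fun j => a (j + 1), fun j => ha _, ?_⟩
  have h1 := (hasSum_nat_add_iff' 1).mpr (hs.mul_left (m : ℝ))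
  have hf : (fun j => (a (j + 1) : ℝ) / (m : ℝ) ^ (j + 1))
      = fun j => (m : ℝ) * ((a (j + 1) : ℝ) / (m : ℝ) ^ (j + 1 + 1)) := by
    funext j
    rw [pow_succ' _ (j + 1)]
    field_simp
  have hy : (m : ℝ) * x - a 0
      = m * x - ∑ i ∈ range 1, (m : ℝ) * ((a i : ℝ) / (m : ℝ) ^ (i + 1)) := by
    rw [sum_range_one, zero_add, pow_one, mul_div_cancel₀ _ hm']
  rw [hf, hy]
  exact h1

lemma missingDigitSet_subset_Icc {m : ℕ} (hm : 1 < m) {D : Finset ℕ}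
    (hD : D ⊆ Finset.range m) : missingDigitSet m D ⊆ Set.Icc 0 1 := by
  rintro x ⟨a, ha, hs⟩
  have hm1 : (1 : ℝ) < m := by exact_mod_cast hm
  have hm0 : (0 : ℝ) < m := by linarith
  refine ⟨hs.nonneg fun j => by positivity, ?_⟩
  have hg := (hasSum_geometric_of_lt_one (r := (m : ℝ)⁻¹) (by positivity)
    (inv_lt_one_of_one_lt₀ hm1)).mul_left (((m : ℝ) - 1) * (m : ℝ)⁻¹)
  have hle : x ≤ ((m : ℝ) - 1) * (m : ℝ)⁻¹ * (1 - (m : ℝ)⁻¹)⁻¹ := by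
    refine hasSum_le (fun j => ?_) hs hg
    have h1 : a j + 1 ≤ m := Finset.mem_range.mp (hD (ha j))
    have h2 : (a j : ℝ) ≤ m - 1 := by
      have : (a j : ℝ) + 1 ≤ m := by exact_mod_cast h1
      linarith
    rw [div_eq_mul_inv, pow_succ', mul_inv, inv_pow, mul_assoc]
    gcongr
  have hne : (m : ℝ) - 1 ≠ 0 := by linarith
  have : ((m : ℝ) - 1) * (m : ℝ)⁻¹ * (1 - (m : ℝ)⁻¹)⁻¹ = 1 := by
    rw [show 1 - (m : ℝ)⁻¹ = (m - 1) * (m : ℝ)⁻¹ by field_simp]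
    exact mul_inv_cancel₀ (by positivity)
  linarith

lemma missingDigitSet_exists_shift_pow {m : ℕ} (hm : 0 < m) {D : Finset ℕ} {x : ℝ}
    (hx : x ∈ missingDigitSet m D) (j : ℕ) :
    ∃ z : ℤ, (m : ℝ) ^ j * x - z ∈ missingDigitSet m D := by
  induction j with
  | zero => exact ⟨0, by simpa using hx⟩
  | succ j ih =>
    obtain ⟨z, hz⟩ := ih
    obtain ⟨c, -, hc⟩ := missingDigitSet_exists_shift hm hz
    refine ⟨m * z + c, ?_⟩
    convert hc using 1
    push_cast
    ring

/-- No integer translate of a point of the set lies in the hole of a missing digit. -/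
lemma missingDigitSet_translate_notMem_hole {m : ℕ} (hm : 1 < m) {D : Finset ℕ}
    (hD : D ⊆ Finset.range m) {d : ℕ} (hdm : d < m) (hd : d ∉ D) {x : ℝ}
    (hx : x ∈ missingDigitSet m D) (z : ℤ) (h1 : (d : ℝ) < m * (x + z))
    (h2 : m * (x + z) < (d : ℝ) + 1) : False := by
  have hm0 : (0 : ℝ) < m := by exact_mod_cast (by omega : 0 < m)
  have hdm' : (d : ℝ) + 1 ≤ m := by exact_mod_cast hdm
  obtain ⟨hx0, hx1⟩ := missingDigitSet_subset_Icc hm hD hx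
  have hz : z = 0 := by
    have hpos : 0 < x + z := by
      by_contra! h
      have : (m : ℝ) * (x + z) ≤ 0 := mul_nonpos_of_nonneg_of_nonpos hm0.le h
      have : (0 : ℝ) ≤ d := by positivity
      linarith
    have hlt : x + z < 1 := by
      by_contra! h
      have : (m : ℝ) * 1 ≤ m * (x + z) := by gcongr
      linarith
    have ha : (-1 : ℝ) < z := by linarith
    have hb : (z : ℝ) < 1 := by linarith
    have ha' : -1 < z := by exact_mod_cast ha
    have hb' : z < 1 := by exact_mod_cast hb
    omega
  subst hz
  obtain ⟨c, hc, hy⟩ := missingDigitSet_exists_shift (by omega) hx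
  obtain ⟨hy0, hy1⟩ := missingDigitSet_subset_Icc hm hD hy
  simp only [Int.cast_zero, add_zero] at h1 h2
  have hcd : (c : ℝ) < d + 1 := by linarith
  have hdc : (d : ℝ) < c + 1 := by linarith
  have hcd' : c < d + 1 := by exact_mod_cast hcd
  have hdc' : d < c + 1 := by exact_mod_cast hdc
  exact hd ((by omega : c = d) ▸ hc)

/-- If `m ^ s * (m ^ S - 1) / q` has denominator exactly `p`, with `p > m` a prime dividing
`m ^ S - 1`, then the orbit of `1 / q` under multiplication by `m` contains a full coset of
`(1 / p) ℤ / ℤ`, so that `1 / q` is not in a missing-digit set. -/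
lemma one_div_notMem_missingDigitSet {m : ℕ} (hm : 1 < m) {D : Finset ℕ}
    (hD : D ⊆ Finset.range m) {d : ℕ} (hdm : d < m) (hd : d ∉ D) {p q s S N : ℕ}
    (hp : p.Prime) (hmp : m < p) (hq : q ≠ 0) (hN : ¬ p ∣ N)
    (h : p * (m ^ s * (m ^ S - 1)) = q * N) (hpS : p ∣ m ^ S - 1) :
    1 / (q : ℝ) ∉ missingDigitSet m D := by
  intro hx
  have hm0 : (0 : ℝ) < m := by exact_mod_cast (by omega : 0 < m)
  have hp0 : (0 : ℝ) < p := by exact_mod_cast hp.pos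
  have hq0 : (q : ℝ) ≠ 0 := by exact_mod_cast hq
  have hone : 1 ≤ m ^ S := Nat.one_le_pow _ _ (by omega)
  have hR : (m : ℝ) ^ s * ((m : ℝ) ^ S - 1) / q = N / p := by
    rw [div_eq_div_iff hq0 hp0.ne']
    have : ((p * (m ^ s * (m ^ S - 1)) : ℕ) : ℝ) = (q * N : ℕ) := by rw [h]
    push_cast [Nat.cast_sub hone] at this
    linarith
  have horbit : ∀ j : ℕ, ∃ z : ℤ,
      (m : ℝ) ^ (s + S * j) * (1 / q) = m ^ s / q + (j * N : ℝ) / p + z := by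
    intro j
    induction j with
    | zero => exact ⟨0, by simp; ring⟩
    | succ j ih =>
      obtain ⟨z, hz⟩ := ih
      have hpj : p ∣ (m ^ S) ^ j - 1 := hpS.trans (by
        simpa using Nat.sub_dvd_pow_sub_pow (m ^ S) 1 j)
      obtain ⟨t, ht⟩ := hpj
      have ht' : ((m : ℝ) ^ S) ^ j = 1 + p * t := by
        have h1 : 1 ≤ (m ^ S) ^ j := Nat.one_le_pow _ _ hone
        have : (m ^ S) ^ j = 1 + p * t := by omega
        exact_mod_cast this
      refine ⟨z + t * N, ?_⟩
      have hstep : (m : ℝ) ^ (s + S * (j + 1)) * (1 / q)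
          = m ^ (s + S * j) * (1 / q) + ((m : ℝ) ^ S) ^ j * (m ^ s * (m ^ S - 1) / q) := by
        rw [← pow_mul]
        ring
      rw [hstep, hz, hR, ht']
      push_cast
      field_simp
      ring
  -- a multiple of `1 / p` moves the base point into the hole
  obtain ⟨k, hk1, hk2⟩ : ∃ k : ℤ, (d : ℝ) < m * (m ^ s / q + (k : ℝ) / p) ∧
      m * (m ^ s / q + (k : ℝ) / p) < (d : ℝ) + 1 := by
    set y : ℝ := m ^ s / q
    -- The first coset point strictly beyond `d / m`; it overshoots by at most `1 / p`.
    refine ⟨⌊p * ((d : ℝ) / m - y)⌋ + 1, ?_, ?_⟩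
    · have := Int.lt_floor_add_one (p * ((d : ℝ) / m - y))
      have h1 : (d : ℝ) / m - y < ((⌊p * ((d : ℝ) / m - y)⌋ + 1 : ℤ) : ℝ) / p := by
        rw [lt_div_iff₀ hp0]
        push_cast
        linarith
      have h2 : (d : ℝ) / m < y + ((⌊p * ((d : ℝ) / m - y)⌋ + 1 : ℤ) : ℝ) / p := by linarith
      rw [div_lt_iff₀ hm0] at h2
      linarith
    · have := Int.floor_le (p * ((d : ℝ) / m - y))
      have h1 : ((⌊p * ((d : ℝ) / m - y)⌋ + 1 : ℤ) : ℝ) / p ≤ (d : ℝ) / m - y + 1 / p := by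
        rw [div_le_iff₀ hp0, add_mul, one_div_mul_cancel hp0.ne']
        push_cast
        linarith
      have h2 : (1 : ℝ) / p < 1 / m :=
        one_div_lt_one_div_of_lt hm0 (by exact_mod_cast hmp)
      have h3 : y + ((⌊p * ((d : ℝ) / m - y)⌋ + 1 : ℤ) : ℝ) / p < ((d : ℝ) + 1) / m := by
        rw [add_div]
        linarith
      rw [lt_div_iff₀ hm0] at h3
      linarith
  obtain ⟨j, t, hj⟩ : ∃ (j : ℕ) (t : ℤ), (j : ℤ) * N = k + p * t := by
    have := Fact.mk hp
    have hN0 : (N : ZMod p) ≠ 0 := by rwa [Ne, ZMod.natCast_eq_zero_iff]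
    refine ⟨((k : ZMod p) * (N : ZMod p)⁻¹).val, ?_⟩
    have : (((((k : ZMod p) * (N : ZMod p)⁻¹).val : ℤ) * N - k : ℤ) : ZMod p) = 0 := by
      push_cast
      rw [ZMod.natCast_zmod_val, inv_mul_cancel_right₀ hN0, sub_self]
    obtain ⟨t, ht⟩ := (ZMod.intCast_zmod_eq_zero_iff_dvd _ _).mp this
    exact ⟨t, by linarith⟩
  obtain ⟨z, hz⟩ := horbit j
  obtain ⟨z', hz'⟩ := missingDigitSet_exists_shift_pow (by omega) hx (s + S * j)
  have hj' : (j : ℝ) * N = k + p * t := by exact_mod_cast hj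
  have heq : (m : ℝ) ^ (s + S * j) * (1 / q) - z' + ((z' - z - t : ℤ) : ℝ)
      = m ^ s / q + (k : ℝ) / p := by
    rw [hz, hj']
    push_cast
    field_simp
    ring
  exact missingDigitSet_translate_notMem_hole hm hD hdm hd hz' (z' - z - t)
    (heq ▸ hk1) (heq ▸ hk2)

lemma prime_le_of_dvd_superFactorial {n l : ℕ} (hl : l.Prime)
    (h : l ∣ ∏ k ∈ Finset.Icc 1 n, k.factorial) : l ≤ n := by
  obtain ⟨k, hk, hlk⟩ := (hl.prime.dvd_finsetProd_iff _).mp h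
  exact ((hl.dvd_factorial).mp hlk).trans (Finset.mem_Icc.mp hk).2

/-- If every prime factor of `r` is at most `n`, then the powers of `m` modulo `r` are eventually
periodic with period dividing `n ! * r`. -/
lemma dvd_pow_mul_pow_sub_one {m n r S : ℕ} (hr : r ≠ 0)
    (hle : ∀ l, l.Prime → l ∣ r → l ≤ n) (hS : n.factorial * r ∣ S) :
    r ∣ m ^ r * (m ^ S - 1) := by
  refine (Nat.dvd_iff_prime_pow_dvd_dvd _ _).mpr fun l e hl hle' => ?_
  rcases Nat.eq_zero_or_pos e with rfl | he
  · simp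
  by_cases hlm : l ∣ m
  · refine Dvd.dvd.mul_right ((pow_dvd_pow_of_dvd hlm e).trans (pow_dvd_pow m ?_)) _
    -- The exponent `r` on `m` suffices because `e < l ^ e ≤ r`.
    exact (Nat.lt_pow_self hl.one_lt).le.trans (Nat.le_of_dvd (Nat.pos_of_ne_zero hr) hle')
  · refine Dvd.dvd.mul_left ?_ _
    have hln : l ≤ n := hle l hl ((dvd_pow_self l he.ne').trans hle')
    have htot : (l ^ e).totient ∣ S := by
      rw [Nat.totient_prime_pow hl he, mul_comm]
      refine (mul_dvd_mul (Nat.dvd_factorial (Nat.sub_pos_of_lt hl.one_lt) (by omega))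
        ((pow_dvd_pow l (Nat.sub_le e 1)).trans hle')).trans hS
    have hcop : m.Coprime (l ^ e) :=
      (((Nat.Prime.coprime_iff_not_dvd hl).mpr hlm).symm).pow_right e
    obtain ⟨c, rfl⟩ := htot
    have h1 : m ^ (l ^ e).totient ≡ 1 [MOD l ^ e] := Nat.ModEq.pow_totient hcop
    have h2 := h1.pow c
    rw [one_pow, ← pow_mul] at h2
    rcases Nat.eq_zero_or_pos (m ^ ((l ^ e).totient * c)) with h0 | h0
    · simp [h0]
    · exact (Nat.modEq_iff_dvd' h0).mp h2.symm

lemma factorial_mul_factorial_dvd_superFactorial (n : ℕ) :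
    (n + 1).factorial * n.factorial ∣ ∏ k ∈ Finset.Icc 1 (n + 1), k.factorial := by
  rw [Finset.prod_Icc_succ_top (by omega), mul_comm]
  refine mul_dvd_mul ?_ dvd_rfl
  rcases Nat.eq_zero_or_pos n with rfl | hn
  · simp
  · exact Finset.dvd_prod_of_mem _ (Finset.mem_Icc.mpr ⟨hn, le_rfl⟩)

/-- Periodicity modulo the `p`-free part forces `(n + 1)!` into `S`. The superfactorial also
contains `n !`, which leaves room to tune the `p`-adic valuation exactly. -/
lemma exists_pow_mul_pow_sub_one_eq_superFactorial_mul {m p n : ℕ} (hm : 1 < m) (hp : p.Prime)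
    (hp2 : p ≠ 2) (hpm : ¬ p ∣ m) (hn : p * (m ^ (p - 1) - 1) ≤ n) :
    ∃ s S N : ℕ, ¬ p ∣ N ∧ p ∣ m ^ S - 1 ∧
      p * (m ^ s * (m ^ S - 1)) = (∏ k ∈ Finset.Icc 1 (n + 1), k.factorial) * N := by
  have := Fact.mk hp
  set q := ∏ k ∈ Finset.Icc 1 (n + 1), k.factorial with hq
  have hq0 : q ≠ 0 := Finset.prod_ne_zero_iff.mpr fun k _ => k.factorial_ne_zero
  have hp1 : p - 1 ≠ 0 := by have := hp.one_lt; omega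
  have hbase : 1 < m ^ (p - 1) := Nat.one_lt_pow hp1 hm
  have hb0 : m ^ (p - 1) - 1 ≠ 0 := by omega
  have hpb : p ∣ m ^ (p - 1) - 1 := by
    have h := Nat.ModEq.pow_totient
      (((Nat.Prime.coprime_iff_not_dvd hp).mpr hpm).symm : m.Coprime p)
    rw [Nat.totient_prime hp] at h
    exact (Nat.modEq_iff_dvd' hbase.le).mp h.symm
  have hpn : p ≤ n := (Nat.le_mul_of_pos_right p (Nat.pos_of_ne_zero hb0)).trans hn
  obtain ⟨v, r, hpr, hqr⟩ := Nat.exists_eq_pow_mul_and_not_dvd hq0 p hp.ne_one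
  have hr0 : r ≠ 0 := by rintro rfl; simp at hpr
  have hvq : padicValNat p q = v := by
    rw [hqr, padicValNat.mul (pow_ne_zero _ hp.ne_zero) hr0, padicValNat.prime_pow,
      padicValNat.eq_zero_of_not_dvd hpr, add_zero]
  obtain ⟨R, hR⟩ : p - 1 ∣ (n + 1).factorial :=
    Nat.dvd_factorial (Nat.pos_of_ne_zero hp1) (by omega)
  have hR0 : R ≠ 0 := by rintro rfl; exact (n + 1).factorial_ne_zero (by simpa using hR)
  have hvR : padicValNat p (n + 1).factorial = padicValNat p R := by
    rw [hR, padicValNat.mul hp1 hR0, padicValNat.eq_zero_of_not_dvd, zero_add]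
    exact Nat.not_dvd_of_pos_of_lt (Nat.pos_of_ne_zero hp1) (by omega)
  have hv : padicValNat p R + (1 + padicValNat p (m ^ (p - 1) - 1)) ≤ v := by
    rw [← hvR, ← hvq]
    have hd : (n + 1).factorial * (p * (m ^ (p - 1) - 1)) ∣ q :=
      (mul_dvd_mul_left _ (Nat.dvd_factorial
        (Nat.mul_pos hp.pos (Nat.pos_of_ne_zero hb0)) hn)).trans
        (factorial_mul_factorial_dvd_superFactorial n)
    have := (padicValNat_dvd_iff_le hq0).mp ((pow_padicValNat_dvd (p := p)).trans hd)
    rwa [padicValNat.mul (Nat.factorial_ne_zero _) (mul_ne_zero hp.ne_zero hb0),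
      padicValNat.mul hp.ne_zero hb0, padicValNat.self hp.one_lt] at this
  obtain ⟨e, he⟩ := Nat.exists_eq_add_of_le hv
  -- `R * r` serves the `p`-free part; `p ^ e` supplies the missing valuation, so that lifting the
  -- exponent gives `v - 1` for `m ^ S - 1`.
  set E := R * r * p ^ e with hE
  have hE0 : E ≠ 0 := mul_ne_zero (mul_ne_zero hR0 hr0) (pow_ne_zero _ hp.ne_zero)
  set S := (p - 1) * E with hS
  have hpS : p ∣ m ^ S - 1 := hpb.trans (by
    simpa [hS, pow_mul] using Nat.sub_dvd_pow_sub_pow (m ^ (p - 1)) 1 E)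
  have hS0 : m ^ S - 1 ≠ 0 := by
    have : 1 < m ^ S := Nat.one_lt_pow (mul_ne_zero hp1 hE0) hm
    omega
  have hvS : 1 + padicValNat p (m ^ S - 1) = v := by
    have h := padicValNat.pow_sub_pow (hp.odd_of_ne_two hp2) hbase hpb
      (fun h => hpm (hp.dvd_of_dvd_pow h)) hE0
    rw [one_pow, ← pow_mul, ← hS, hE, padicValNat.mul (mul_ne_zero hR0 hr0)
      (pow_ne_zero _ hp.ne_zero), padicValNat.mul hR0 hr0, padicValNat.prime_pow,
      padicValNat.eq_zero_of_not_dvd hpr] at h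
    omega
  have hrd : r ∣ m ^ r * (m ^ S - 1) := by
    refine dvd_pow_mul_pow_sub_one (n := n + 1) hr0 (fun l hl hlr => ?_) ?_
    · exact prime_le_of_dvd_superFactorial hl ((hlr.trans (Dvd.intro_left _ hqr.symm)))
    · rw [hR, hS, hE]
      exact ⟨p ^ e, by ring⟩
  have hm0 : m ^ r ≠ 0 := pow_ne_zero _ (by omega)
  have hval : padicValNat p (p * (m ^ r * (m ^ S - 1))) = v := by
    rw [padicValNat.mul hp.ne_zero (mul_ne_zero hm0 hS0), padicValNat.mul hm0 hS0,
      padicValNat.self hp.one_lt,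
      padicValNat.eq_zero_of_not_dvd (fun h => hpm (hp.dvd_of_dvd_pow h)), zero_add, hvS]
  have hqd : q ∣ p * (m ^ r * (m ^ S - 1)) := by
    rw [hqr]
    refine Nat.Coprime.mul_dvd_of_dvd_of_dvd
      (((Nat.Prime.coprime_iff_not_dvd hp).mpr hpr).pow_left v) ?_ (hrd.mul_left p)
    rw [← hval]
    exact pow_padicValNat_dvd
  obtain ⟨N, hN⟩ := hqd
  refine ⟨r, S, N, fun hpN => ?_, hpS, hN⟩
  have hN0 : N ≠ 0 := by
    rintro rfl
    exact mul_ne_zero hp.ne_zero (mul_ne_zero hm0 hS0) (by simpa using hN)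
  rw [hN, padicValNat.mul hq0 hN0, hvq] at hval
  have := one_le_padicValNat_of_dvd hN0 hpN
  omega

theorem mainTheorem8 (m : ℕ) (hm : 3 ≤ m) (D : Finset ℕ) (hD : D ⊆ Finset.range m)
    (hD_one : 1 < D.card) (hD_lt : D.card < m) :
    ({x : ℝ | ∃ n : ℕ, 1 ≤ n ∧ x = 1 / ((∏ k ∈ Finset.Icc 1 n, Nat.factorial k : ℕ) : ℝ)} ∩
      missingDigitSet m D).Finite := by
  obtain ⟨d, hdm, hd⟩ : ∃ d ∈ Finset.range m, d ∉ D :=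
    Finset.exists_mem_notMem_of_card_lt_card (by simpa using hD_lt)
  obtain ⟨p, hmp, hp⟩ := Nat.exists_infinite_primes (m + 1)
  have hpm : ¬ p ∣ m := Nat.not_dvd_of_pos_of_lt (by omega) (by omega)
  refine ((Set.finite_Iic (p * (m ^ (p - 1) - 1))).image fun n : ℕ =>
    1 / ((∏ k ∈ Finset.Icc 1 n, Nat.factorial k : ℕ) : ℝ)).subset ?_
  rintro x ⟨⟨n, hn, rfl⟩, hx⟩
  refine ⟨n, ?_, rfl⟩
  by_contra hlt
  obtain ⟨n, rfl⟩ := Nat.exists_eq_add_of_le' hn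
  obtain ⟨s, S, N, hN, hpS, h⟩ := exists_pow_mul_pow_sub_one_eq_superFactorial_mul
    (n := n) (by omega : 1 < m) hp (by omega) hpm (by simp only [Set.mem_Iic] at hlt; omega)
  exact one_div_notMem_missingDigitSet (by omega) hD (Finset.mem_range.mp hdm) hd hp (by omega)
    (Finset.prod_ne_zero_iff.mpr fun k _ => k.factorial_ne_zero) hN h hpS hx
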